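/- Let $k,\mu,\nu,\lambda$ be complex numbers such that $\lambda\notin\{0,-1,-2,\dots\}$ and $\mu,\nu,\mu+\nu\notin\{-1,-2,-3,\dots\}$. Write $(c)_g=\Gamma(c+g)/\Gamma(c)$ for the Pochhammer symbol (so $(c)_n=c(c+1)\cdots(c+n-1)$ for integers $n\ge 0$) and ${}_pF_q(a_1,\dots,a_p;b_1,\dots,b_q;z)=\sum_{n\ge 0}\frac{(a_1)_n\cdots(a_p)_n}{(b_1)_n\cdots(b_q)_n}\frac{z^n}{n!}$. Put $$A(\lambda)=\frac{\Gamma(\lambda+1)\,2^{\mu+\nu}\,\Gamma(\mu+1)\Gamma(\nu+1)}{\sqrt{\pi}\,\Gamma(\lambda+\frac12)\,\Gamma(\lambda)^2},$$ $$B_L(\lambda)=\frac{(-1)^{2L}k^{4L}\left(\left(\lambda+\frac12\right)_{2L}\right)^2\Gamma(2L+2\lambda)\,2^{4L-2\lambda-\mu-\nu+1}}{(2L)!\,(2L+\lambda)\left((2\lambda)_{2L}\right)^2\left((2L+2\lambda)_{2L}\right)^2\left(L+\frac12\right)_{\mu+\frac12}\left(L+\frac12\right)_{\nu+\frac12}}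 .$$ If $\lambda\notin\{-\frac12,-\frac32,-\frac52,\dots\}$, then $${}_3F_4\left(\tfrac12,\tfrac{\mu}{2}+\tfrac{\nu}{2}+\tfrac12,\tfrac{\mu}{2}+\tfrac{\nu}{2}+1;\lambda+1,\mu+1,\nu+1,\mu+\nu+1;-k^2\right)$$ $$=A(\lambda)\sum_{L=0}^{\infty}B_L(\lambda)\;{}_1F_2\left(L+\tfrac12;2L+\lambda+1,L+\mu+1;-\tfrac{k^2}{4}\right)\,{}_1F_2\left(L+\tfrac12;2L+\lambda+1,L+\nu+1;-\tfrac{k^2}{4}\right),$$ and the series converges absolutely. Moreover, for every admissible $\lambda$, including $\lambda\in\{-\frac12,-\frac32,\dots\}$, the limit $c_L=\lim_{\lambda'\to\lambda,\ \lambda'\neq\lambda}A(\lambda')B_L(\lambda')$ exists for every $L\ge 0$, and the identity holds, with absolute convergence, when $A(\lambda)B_L(\lambda)$ is replaced by $c_L$ for each $L$. -/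

import Mathlib

open Filter Topology

noncomputable section

/-- The Pochhammer symbol (rising factorial) `(c)_n = c (c + 1) ⋯ (c + n - 1)` with a natural
number index. -/
def risingFactorial (c : ℂ) (n : ℕ) : ℂ := (ascPochhammer ℂ n).eval c

/-- The Pochhammer symbol `(c)_g = Γ(g + c) / Γ(c)` with an arbitrary complex index. -/
def pochhammerGamma (c g : ℂ) : ℂ := Complex.Gamma (g + c) / Complex.Gamma c

/-- The generalized hypergeometric series `pFq(a; b; z)` with the list `a` of upper parameters
and the list `b` of lower parameters (none of which should be a nonpositive integer). -/
def hypergeometricPFQ (a b : List ℂ) (z : ℂ) : ℂ :=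
  ∑' n : ℕ, (a.map fun c => risingFactorial c n).prod / (b.map fun c => risingFactorial c n).prod
    * z ^ n / (n.factorial : ℂ)

/-- The function `3F4` of the left-hand side. -/
def lhs3F4 (k μ ν lam : ℂ) : ℂ :=
  hypergeometricPFQ [1 / 2, μ / 2 + ν / 2 + 1 / 2, μ / 2 + ν / 2 + 1]
    [lam + 1, μ + 1, ν + 1, μ + ν + 1] (-k ^ 2)

/-- The factor in front of the sum. -/
def gegenbauerPrefactor (μ ν lam : ℂ) : ℂ :=
  Complex.Gamma (lam + 1) * (2 : ℂ) ^ (μ + ν) * Complex.Gamma (μ + 1) * Complex.Gamma (ν + 1) /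
    ((Real.sqrt Real.pi : ℂ) * Complex.Gamma (lam + 1 / 2) * Complex.Gamma lam ^ 2)

/-- The coefficient of the product of the two `1F2` functions in the `L`-th term of the sum. -/
def gegenbauerCoeff (k μ ν lam : ℂ) (L : ℕ) : ℂ :=
  (-1) ^ (2 * L) * k ^ (4 * L) * risingFactorial (lam + 1 / 2) (2 * L) ^ 2 *
      Complex.Gamma (2 * L + 2 * lam) * (2 : ℂ) ^ (4 * L - 2 * lam - μ - ν + 1) /
    (((2 * L).factorial : ℂ) * (2 * L + lam) * risingFactorial (2 * lam) (2 * L) ^ 2 *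
      risingFactorial (2 * L + 2 * lam) (2 * L) ^ 2 *
      pochhammerGamma (L + 1 / 2) (μ + 1 / 2) * pochhammerGamma (L + 1 / 2) (ν + 1 / 2))

/-- The product of the two `1F2` functions in the `L`-th term of the sum. -/
def pairProduct1F2 (k μ ν lam : ℂ) (L : ℕ) : ℂ :=
  hypergeometricPFQ [L + 1 / 2] [2 * L + lam + 1, L + μ + 1] (-k ^ 2 / 4) *
    hypergeometricPFQ [L + 1 / 2] [2 * L + lam + 1, L + ν + 1] (-k ^ 2 / 4)

end

/-!
The sum over `L` comes from summing one absolutely convergent triple series in two ways.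

Put `z = -k² / 4`. After cancelling Gamma functions by Legendre's duplication formula, the product
of the prefactor and the `L`-th coefficient becomes
`limitCoeff = z^(2L) (1/2)_L (lam)_L (lam + 1/2)_L /
  (L! (lam)_{2L} (lam + 1)_{2L} (μ + 1)_L (ν + 1)_L)`,
which has no singularity at `lam = -1/2, -3/2, …`. It is therefore the limit in the second half of
the theorem, and both halves follow from the identity with `limitCoeff` as coefficient.

Expand the two `₁F₂` functions with summation indices `i` and `j`. The terms of the triple series
over `(L, i, j)` are bounded by `M₁^L / L! * M₂^i / i! * M₃^j / j!`, so it may be reindexed by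
`a = L + i`, `b = L + j` and `L`. For fixed `a` and `b` the sum over `L` is a terminating
very-well-poised `₅F₄`, evaluated by Dougall's formula (`sum_wellPoisedTerm`, proved here with a
Wilf–Zeilberger mate). What is left is
`z^(a+b) (1/2)_{a+b} / (lam + 1)_{a+b} / ((μ + 1)_a (ν + 1)_b a! b!)`, and the Chu–Vandermonde
convolution (`sum_antidiagonal_inv_risingFactorial`) over `a + b = N` yields the `N`-th term of the
`₃F₄`.
-/

/-! ### Pochhammer symbols -/

theorem risingFactorial_zero (c : ℂ) : risingFactorial c 0 = 1 := by
  simp [risingFactorial]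

theorem risingFactorial_succ (c : ℂ) (n : ℕ) :
    risingFactorial c (n + 1) = risingFactorial c n * (c + n) :=
  ascPochhammer_succ_eval n c

theorem risingFactorial_add (c : ℂ) (m n : ℕ) :
    risingFactorial c (m + n) = risingFactorial c m * risingFactorial (c + m) n := by
  induction n with
  | zero => simp [risingFactorial_zero]
  | succ n ih => rw [← add_assoc, risingFactorial_succ, ih, risingFactorial_succ]; push_cast; ring

theorem risingFactorial_add_one_left {c : ℂ} (hc : c ≠ 0) (n : ℕ) :
    risingFactorial (c + 1) n = risingFactorial c n * (c + n) / c := by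
  have h := risingFactorial_add c 1 n
  rw [add_comm, risingFactorial_succ, risingFactorial_succ, risingFactorial_zero, Nat.cast_zero,
    Nat.cast_one, add_zero, one_mul] at h
  rw [eq_div_iff hc, h, mul_comm]

theorem risingFactorial_ne_zero {c : ℂ} (hc : ∀ m : ℕ, c ≠ -(m : ℂ)) (n : ℕ) :
    risingFactorial c n ≠ 0 := by
  induction n with
  | zero => simp [risingFactorial_zero]
  | succ n ih =>
    rw [risingFactorial_succ]
    exact mul_ne_zero ih fun h => hc n (eq_neg_of_add_eq_zero_left h)

/-- Duplication formula for the Pochhammer symbol. -/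
theorem risingFactorial_two_mul (c : ℂ) (n : ℕ) :
    risingFactorial (2 * c) (2 * n) =
      4 ^ n * risingFactorial c n * risingFactorial (c + 1 / 2) n := by
  induction n with
  | zero => simp [risingFactorial_zero]
  | succ n ih =>
    rw [show 2 * (n + 1) = 2 * n + 1 + 1 by ring, risingFactorial_succ, risingFactorial_succ, ih,
      risingFactorial_succ, risingFactorial_succ]
    push_cast; ring

theorem add_natCast_ne_neg_natCast {c : ℂ} (hc : ∀ m : ℕ, c ≠ -(m : ℂ)) (n m : ℕ) :
    c + n ≠ -(m : ℂ) := fun h => hc (m + n) (by push_cast; linear_combination h)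

theorem half_ne_neg_natCast (m : ℕ) : (1 / 2 : ℂ) ≠ -(m : ℂ) := by
  intro h
  have := congrArg Complex.re h
  norm_num at this
  have hm : (0 : ℝ) ≤ m := m.cast_nonneg
  linarith

theorem Gamma_add_natCast {c : ℂ} (hc : ∀ m : ℕ, c ≠ -(m : ℂ)) (n : ℕ) :
    Complex.Gamma (c + n) = risingFactorial c n * Complex.Gamma c := by
  induction n with
  | zero => simp [risingFactorial_zero]
  | succ n ih =>
    have h : c + n ≠ 0 := by simpa using add_natCast_ne_neg_natCast hc n 0
    rw [risingFactorial_succ, Nat.cast_succ, ← add_assoc, Complex.Gamma_add_one _ h, ih]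
    ring

theorem risingFactorial_one (n : ℕ) : risingFactorial 1 n = (n.factorial : ℂ) := by
  simp [risingFactorial, ascPochhammer_eval_one]

theorem factorial_two_mul (n : ℕ) :
    ((2 * n).factorial : ℂ) = 4 ^ n * risingFactorial (1 / 2) n * (n.factorial : ℂ) := by
  have h := risingFactorial_two_mul (1 / 2) n
  rw [show (2 : ℂ) * (1 / 2) = 1 by norm_num, show (1 / 2 : ℂ) + 1 / 2 = 1 by norm_num,
    risingFactorial_one, risingFactorial_one] at h
  exact h

/-! ### The Chu–Vandermonde convolution -/

/-- The Chu–Vandermonde convolution. It gives the coefficients of the product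
`₀F₁(; p; z) * ₀F₁(; q; z)`. -/
theorem sum_antidiagonal_inv_risingFactorial {p q : ℂ} (hp : ∀ m : ℕ, p ≠ -(m : ℂ))
    (hq : ∀ m : ℕ, q ≠ -(m : ℂ)) (N : ℕ) :
    ∑ ij ∈ Finset.HasAntidiagonal.antidiagonal N,
      1 / (risingFactorial p ij.1 * risingFactorial q ij.2 * (ij.1.factorial : ℂ) *
        (ij.2.factorial : ℂ)) =
    risingFactorial (p + q - 1 + N) N /
      (risingFactorial p N * risingFactorial q N * (N.factorial : ℂ)) := by
  -- `(c)_{i+j} / (c)_i` is a falling factorial of `c + i + j - 1`, whose base depends only on the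
  -- total `i + j`, so that the binomial theorem for falling factorials applies.
  have key : ∀ (c : ℂ) (i j : ℕ), risingFactorial c (i + j) =
      risingFactorial c i * (descPochhammer ℤ j).smeval (c + (i + j : ℕ) - 1) := by
    intro c i j
    rw [risingFactorial_add, ← Polynomial.aeval_eq_smeval, Polynomial.aeval_def,
      ← Polynomial.eval_map, descPochhammer_map, descPochhammer_eval_eq_ascPochhammer,
      show c + (i + j : ℕ) - 1 - j + 1 = c + i by push_cast; ring]
    rfl
  have hV := Ring.descPochhammer_smeval_add N
    (Commute.all (q + (N : ℕ) - 1) (p + (N : ℕ) - 1))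
  have h1 : risingFactorial (p + q - 1 + N) N =
      (descPochhammer ℤ N).smeval (q + (N : ℕ) - 1 + (p + (N : ℕ) - 1)) := by
    have := key (p + q - 1 + N) 0 N
    rw [risingFactorial_zero, zero_add, one_mul] at this
    rw [this]; congr 1; ring
  rw [h1, hV, Finset.sum_div]
  refine Finset.sum_congr rfl fun ij hij => ?_
  obtain ⟨i, j⟩ := ij
  obtain rfl : i + j = N := Finset.HasAntidiagonal.mem_antidiagonal.1 hij
  have hP := key p i j
  have hQ := key q j i
  rw [add_comm j i] at hQ
  have hi := risingFactorial_ne_zero hp i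
  have hj := risingFactorial_ne_zero hq j
  have hPn := risingFactorial_ne_zero hp (i + j)
  have hQn := risingFactorial_ne_zero hq (i + j)
  have hc := Nat.add_choose_mul_factorial_mul_factorial i j
  rw [← Nat.choose_symm_add] at hc
  have hc' : ((i + j).choose i : ℂ) * i.factorial * j.factorial = (i + j).factorial := by
    exact_mod_cast hc
  have := Nat.cast_ne_zero (R := ℂ).2 (Nat.factorial_ne_zero i)
  have := Nat.cast_ne_zero (R := ℂ).2 (Nat.factorial_ne_zero j)
  have := Nat.cast_ne_zero (R := ℂ).2 (Nat.factorial_ne_zero (i + j))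
  rw [div_eq_div_iff (by positivity) (by positivity)]
  rw [hP, hQ, ← hc']
  ring

/-! ### Dougall's sum of the terminating very-well-poised series -/

/-- The summand of the terminating very-well-poised `₅F₄` series with parameters
`lam, 1 + lam / 2, lam + 1 / 2, -a, -b`, divided by `(lam + 1)_a (lam + 1)_b`. The symbols
`(-a)_L` and `(-b)_L` are written as descending factorials, so the summand vanishes for
`L > min a b`. -/
noncomputable def wellPoisedTerm (lam : ℂ) (a b L : ℕ) : ℂ :=
  (lam + 2 * L) / lam * risingFactorial lam L * risingFactorial (lam + 1 / 2) L *
      (a.descFactorial L : ℂ) * (b.descFactorial L : ℂ) /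
    ((L.factorial : ℂ) * risingFactorial (1 / 2) L * risingFactorial (lam + 1) (a + L) *
      risingFactorial (lam + 1) (b + L))

/-- The Wilf–Zeilberger mate of `wellPoisedTerm` for the recurrence in `a`. -/
noncomputable def wellPoisedMate (lam : ℂ) (a b L : ℕ) : ℂ :=
  -(1 / lam) / (a + 1) * L * (L - 1 / 2) * (lam + b + L) * risingFactorial lam L *
      risingFactorial (lam + 1 / 2) L * ((a + 1).descFactorial L : ℂ) * (b.descFactorial L : ℂ) /
    ((L.factorial : ℂ) * risingFactorial (1 / 2) L * risingFactorial (lam + 1) (a + L) *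
      risingFactorial (lam + 1) (b + L))

theorem natCast_descFactorial_succ (n L : ℕ) :
    (n.descFactorial (L + 1) : ℂ) = ((n : ℂ) - L) * n.descFactorial L := by
  rw [Nat.descFactorial_succ]
  rcases le_total L n with h | h
  · push_cast [h]; ring
  · rcases h.eq_or_lt with rfl | h
    · simp
    · simp [Nat.descFactorial_of_lt h]

theorem natCast_mul_succ_descFactorial (n L : ℕ) :
    ((n : ℂ) + 1 - L) * ((n + 1).descFactorial L : ℂ) = (n + 1) * n.descFactorial L := by
  rw [← Nat.cast_succ, ← natCast_descFactorial_succ, Nat.succ_descFactorial_succ]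
  push_cast; ring

theorem wellPoisedTerm_recurrence {lam : ℂ} (hlam : ∀ m : ℕ, lam ≠ -(m : ℂ)) (a b L : ℕ) :
    (lam + 1 + a + b) * (1 / 2 + a) * wellPoisedTerm lam (a + 1) b L -
      (1 / 2 + a + b) * wellPoisedTerm lam a b L =
    wellPoisedMate lam a b (L + 1) - wellPoisedMate lam a b L := by
  have h0 : lam ≠ 0 := by simpa using hlam 0
  have ha : (a : ℂ) + 1 ≠ 0 := Nat.cast_add_one_ne_zero a
  have hL : (L : ℂ) + 1 ≠ 0 := Nat.cast_add_one_ne_zero L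
  have hlam1 : ∀ m : ℕ, lam + 1 ≠ -(m : ℂ) := by
    simpa using add_natCast_ne_neg_natCast hlam 1
  have hhL : (1 / 2 : ℂ) + L ≠ 0 := by
    simpa using add_natCast_ne_neg_natCast half_ne_neg_natCast L 0
  have haL : lam + 1 + (a + L : ℕ) ≠ 0 := by
    simpa using add_natCast_ne_neg_natCast hlam1 (a + L) 0
  have hbL : lam + 1 + (b + L : ℕ) ≠ 0 := by
    simpa using add_natCast_ne_neg_natCast hlam1 (b + L) 0
  have e : (a.descFactorial L : ℂ) =
      ((a : ℂ) + 1 - L) * ((a + 1).descFactorial L : ℂ) / (a + 1) := by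
    rw [natCast_mul_succ_descFactorial]; field_simp
  have hA := risingFactorial_ne_zero hlam1 (a + L)
  have hB := risingFactorial_ne_zero hlam1 (b + L)
  have hH := risingFactorial_ne_zero half_ne_neg_natCast L
  have hF := Nat.cast_ne_zero (R := ℂ).2 (Nat.factorial_ne_zero L)
  unfold wellPoisedTerm wellPoisedMate
  rw [e, natCast_descFactorial_succ (a + 1), natCast_descFactorial_succ b,
    show a + 1 + L = a + L + 1 by ring, ← add_assoc, ← add_assoc, Nat.factorial_succ]
  simp only [risingFactorial_succ]
  generalize risingFactorial (lam + 1) (a + L) = A at *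
  generalize risingFactorial (lam + 1) (b + L) = B at *
  generalize risingFactorial (1 / 2) L = H at *
  generalize risingFactorial lam L = R1 at *
  generalize risingFactorial (lam + 1 / 2) L = R2 at *
  generalize ((a + 1).descFactorial L : ℂ) = D1 at *
  generalize (b.descFactorial L : ℂ) = D2 at *
  push_cast at haL hbL ⊢
  generalize (L.factorial : ℂ) = F at *
  have hhL' : (1 : ℂ) + 2 * L ≠ 0 := by
    intro h; apply hhL; linear_combination h / 2
  field_simp
  ring

/-- Dougall's summation of the terminating very-well-poised `₅F₄` series. Both sides satisfy the
same first-order recurrence in `a`, by telescoping `wellPoisedMate`. -/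
theorem sum_wellPoisedTerm {lam : ℂ} (hlam : ∀ m : ℕ, lam ≠ -(m : ℂ)) (a b : ℕ) :
    ∑ L ∈ Finset.range (b + 1), wellPoisedTerm lam a b L =
      risingFactorial (1 / 2) (a + b) / (risingFactorial (lam + 1) (a + b) *
        risingFactorial (1 / 2) a * risingFactorial (1 / 2) b) := by
  have hlam1 : ∀ m : ℕ, lam + 1 ≠ -(m : ℂ) := by
    simpa using add_natCast_ne_neg_natCast hlam 1
  have h0 : lam ≠ 0 := by simpa using hlam 0
  induction a with
  | zero =>
    rw [Finset.sum_eq_single_of_mem 0 (by simp)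
      (fun L _ hL => by
        simp [wellPoisedTerm, Nat.descFactorial_of_lt (Nat.pos_of_ne_zero hL)])]
    have := risingFactorial_ne_zero hlam1 b
    have := risingFactorial_ne_zero half_ne_neg_natCast b
    simp only [wellPoisedTerm, risingFactorial_zero, Nat.descFactorial_zero, zero_add, add_zero,
      Nat.factorial_zero, Nat.cast_zero, Nat.cast_one]
    field_simp
    simp
  | succ a ih =>
    have h1 : lam + 1 + (a + b : ℕ) ≠ 0 := by
      simpa using add_natCast_ne_neg_natCast hlam1 (a + b) 0
    have h2 : (1 / 2 : ℂ) + a ≠ 0 := by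
      simpa using add_natCast_ne_neg_natCast half_ne_neg_natCast a 0
    -- The mate vanishes at `L = 0` because of its factor `L`, and at `L = b + 1` because
    -- `b.descFactorial (b + 1) = 0`.
    have htel : ∑ L ∈ Finset.range (b + 1),
        ((lam + 1 + a + b) * (1 / 2 + a) * wellPoisedTerm lam (a + 1) b L -
          (1 / 2 + a + b) * wellPoisedTerm lam a b L) = 0 := by
      rw [Finset.sum_congr rfl fun L _ => wellPoisedTerm_recurrence hlam a b L,
        Finset.sum_range_sub]
      simp [wellPoisedMate]
    rw [Finset.sum_sub_distrib, ← Finset.mul_sum, ← Finset.mul_sum, ih] at htel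
    have hA := risingFactorial_ne_zero hlam1 (a + b)
    have hB := risingFactorial_ne_zero half_ne_neg_natCast a
    have hC := risingFactorial_ne_zero half_ne_neg_natCast b
    rw [show a + 1 + b = a + b + 1 by ring]
    simp only [risingFactorial_succ]
    have h3 : lam + 1 + a + b ≠ 0 := by push_cast at h1; rwa [← add_assoc] at h1
    have h2' : (1 : ℂ) + 2 * a ≠ 0 := fun h => h2 (by linear_combination h / 2)
    apply mul_left_cancel₀ (mul_ne_zero h3 h2)
    rw [sub_eq_zero.1 htel]
    push_cast at h1 ⊢
    field_simp
    ring

/-! ### The coefficients and their limits -/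

/-- The closed form of `gegenbauerPrefactor * gegenbauerCoeff`, free of Gamma functions. Unlike
that product it is regular at `lam = -1/2, -3/2, …`. -/
noncomputable def limitCoeff (k μ ν lam : ℂ) (L : ℕ) : ℂ :=
  (-k ^ 2 / 4) ^ (2 * L) * risingFactorial (1 / 2) L * risingFactorial lam L *
      risingFactorial (lam + 1 / 2) L /
    ((L.factorial : ℂ) * risingFactorial lam (2 * L) * risingFactorial (lam + 1) (2 * L) *
      risingFactorial (μ + 1) L * risingFactorial (ν + 1) L)

theorem Gamma_one_half : Complex.Gamma (1 / 2) = (Real.sqrt Real.pi : ℂ) := by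
  have h := Complex.Gamma_mul_Gamma_add_half (1 / 2)
  norm_num [Complex.Gamma_one] at h
  simpa using h

theorem two_mul_ne_neg_natCast {lam : ℂ} (hlam : ∀ m : ℕ, lam ≠ -(m : ℂ))
    (hhalf : ∀ m : ℕ, lam + 1 / 2 ≠ -(m : ℂ)) (m : ℕ) : 2 * lam ≠ -(m : ℂ) := by
  intro h
  rcases Nat.even_or_odd' m with ⟨n, rfl | rfl⟩
  · exact hlam n (by push_cast at h; linear_combination h / 2)
  · exact hhalf n (by push_cast at h; linear_combination h / 2)

theorem gegenbauerPrefactor_mul_gegenbauerCoeff {μ ν lam : ℂ} (k : ℂ)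
    (hlam : ∀ m : ℕ, lam ≠ -(m : ℂ)) (hhalf : ∀ m : ℕ, lam + 1 / 2 ≠ -(m : ℂ))
    (hμ : ∀ m : ℕ, μ + 1 ≠ -(m : ℂ)) (hν : ∀ m : ℕ, ν + 1 ≠ -(m : ℂ)) (L : ℕ) :
    gegenbauerPrefactor μ ν lam * gegenbauerCoeff k μ ν lam L = limitCoeff k μ ν lam L := by
  have h2lam := two_mul_ne_neg_natCast hlam hhalf
  have h0 : lam ≠ 0 := by simpa using hlam 0
  have hl2 : lam + 2 * L ≠ 0 := by simpa using add_natCast_ne_neg_natCast hlam (2 * L) 0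
  have hlam1 : ∀ m : ℕ, lam + 1 ≠ -(m : ℂ) := by
    simpa using add_natCast_ne_neg_natCast hlam 1
  have hG1 : Complex.Gamma (lam + 1) = lam * Complex.Gamma lam := Complex.Gamma_add_one _ h0
  have hG2 : Complex.Gamma (2 * L + 2 * lam) =
      risingFactorial (2 * lam) (2 * L) * Complex.Gamma (2 * lam) := by
    rw [← Gamma_add_natCast h2lam]; congr 1; push_cast; ring
  have hP : ∀ c : ℂ, (∀ m : ℕ, c + 1 ≠ -(m : ℂ)) → pochhammerGamma (L + 1 / 2) (c + 1 / 2) =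
      risingFactorial (c + 1) L * Complex.Gamma (c + 1) /
        (risingFactorial (1 / 2) L * (Real.sqrt Real.pi : ℂ)) := by
    intro c hc
    rw [pochhammerGamma, ← Gamma_add_natCast hc, ← Gamma_one_half,
      ← Gamma_add_natCast half_ne_neg_natCast]
    congr 2 <;> ring
  have hpow : (2 : ℂ) ^ (μ + ν) * (2 : ℂ) ^ (4 * L - 2 * lam - μ - ν + 1) =
      (4 : ℂ) ^ L * 4 ^ L * 2 ^ (1 - 2 * lam) := by
    rw [← Complex.cpow_add _ _ two_ne_zero,
      show μ + ν + (4 * L - 2 * lam - μ - ν + 1) = ((4 * L : ℕ) : ℂ) + (1 - 2 * lam) by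
        push_cast; ring,
      Complex.cpow_add _ _ two_ne_zero, Complex.cpow_natCast, pow_mul, ← mul_pow]
    norm_num
  have hk : (-k ^ 2 / 4) ^ (2 * L) = k ^ (4 * L) / (4 ^ L * 4 ^ L) := by
    rw [← mul_pow, pow_mul, pow_mul k, ← div_pow]; congr 1; ring
  have hR := risingFactorial_add_one_left h0 (2 * L)
  push_cast at hR
  have hX := risingFactorial_two_mul lam L
  have hXY : risingFactorial (2 * lam) (2 * L) * risingFactorial (2 * L + 2 * lam) (2 * L) =
      4 ^ L * 4 ^ L * risingFactorial lam (2 * L) * risingFactorial (lam + 1 / 2) (2 * L) := by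
    have h := risingFactorial_two_mul lam (2 * L)
    rw [two_mul (2 * L), risingFactorial_add] at h
    rw [← pow_add, ← two_mul, ← h]
    congr 2; push_cast; ring
  have hXne := risingFactorial_ne_zero h2lam (2 * L)
  have hdup := Complex.Gamma_mul_Gamma_add_half lam
  have hg := Complex.Gamma_ne_zero hlam
  have hgh := Complex.Gamma_ne_zero hhalf
  have hg2 := Complex.Gamma_ne_zero h2lam
  have hgμ := Complex.Gamma_ne_zero hμ
  have hgν := Complex.Gamma_ne_zero hν
  have hs : (Real.sqrt Real.pi : ℂ) ≠ 0 := by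
    rw [← Gamma_one_half]; exact Complex.Gamma_ne_zero half_ne_neg_natCast
  have hw : (2 : ℂ) ^ (1 - 2 * lam) ≠ 0 := by simp [Complex.cpow_eq_zero_iff]
  have hμL := risingFactorial_ne_zero hμ L
  have hνL := risingFactorial_ne_zero hν L
  have hH := risingFactorial_ne_zero half_ne_neg_natCast L
  have hlL := risingFactorial_ne_zero hlam L
  have hl2L := risingFactorial_ne_zero hlam (2 * L)
  have hhL := risingFactorial_ne_zero hhalf L
  have hh2L := risingFactorial_ne_zero hhalf (2 * L)
  have hF := Nat.cast_ne_zero (R := ℂ).2 (Nat.factorial_ne_zero L)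
  have h4 : (4 : ℂ) ^ L ≠ 0 := pow_ne_zero _ (by norm_num)
  rw [gegenbauerPrefactor, gegenbauerCoeff, limitCoeff, hG1, hG2, hP μ hμ, hP ν hν, hk, hR,
    factorial_two_mul, eq_div_of_mul_eq hXne ((mul_comm _ _).trans hXY),
    eq_div_of_mul_eq hg ((mul_comm _ _).trans hdup), hX,
    eq_div_of_mul_eq (by simp [Complex.cpow_eq_zero_iff]) ((mul_comm _ _).trans hpow),
    (even_two_mul L).neg_one_pow, add_comm (2 * (L : ℂ)) lam]
  have hμν : (2 : ℂ) ^ (μ + ν) ≠ 0 := by simp [Complex.cpow_eq_zero_iff]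
  generalize (2 : ℂ) ^ (μ + ν) = w1 at *
  generalize (2 : ℂ) ^ (1 - 2 * lam) = w at *
  generalize (Real.sqrt Real.pi : ℂ) = s at *
  generalize Complex.Gamma (2 * lam) = g at *
  generalize risingFactorial (lam + 1 / 2) L = q at *
  generalize risingFactorial (lam + 1 / 2) (2 * L) = q' at *
  field_simp

/-- A punctured neighbourhood of `lam` contains no half-integers `-m / 2`. -/
theorem eventually_two_mul_ne_neg_natCast (lam : ℂ) :
    ∀ᶠ l in 𝓝[≠] lam, ∀ m : ℕ, 2 * l ≠ -(m : ℂ) := by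
  -- Every set of integers is closed in `ℂ`; remove from `ℤ` the point `2 * lam`, if it is there.
  have hcl : IsClosed ((fun n : ℤ => (n : ℂ)) '' {n : ℤ | (n : ℂ) ≠ 2 * lam}) :=
    Complex.isClosedEmbedding_intCast.isClosedMap _ (isClosed_discrete _)
  have hmem : 2 * lam ∈ ((fun n : ℤ => (n : ℂ)) '' {n : ℤ | (n : ℂ) ≠ 2 * lam})ᶜ := by
    rintro ⟨n, hn, h⟩
    exact hn h
  have hc : Tendsto (fun l : ℂ => 2 * l) (𝓝[≠] lam) (𝓝 (2 * lam)) :=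
    ((continuous_const.mul continuous_id).tendsto lam).mono_left nhdsWithin_le_nhds
  filter_upwards [hc.eventually (hcl.isOpen_compl.mem_nhds hmem), self_mem_nhdsWithin]
    with l hl hne m hm
  refine hl ⟨-(m : ℤ), ?_, by simp [hm]⟩
  intro h
  push_cast at h
  exact hne (mul_left_cancel₀ two_ne_zero (hm.trans h))

theorem continuous_risingFactorial (n : ℕ) : Continuous fun c => risingFactorial c n :=
  (ascPochhammer ℂ n).continuous

theorem tendsto_gegenbauerPrefactor_mul_gegenbauerCoeff {μ ν lam : ℂ} (k : ℂ)
    (hlam : ∀ m : ℕ, lam ≠ -(m : ℂ)) (hμ : ∀ m : ℕ, μ + 1 ≠ -(m : ℂ))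
    (hν : ∀ m : ℕ, ν + 1 ≠ -(m : ℂ)) (L : ℕ) :
    Tendsto (fun l : ℂ => gegenbauerPrefactor μ ν l * gegenbauerCoeff k μ ν l L)
      (𝓝[≠] lam) (𝓝 (limitCoeff k μ ν lam L)) := by
  have hlam1 : ∀ m : ℕ, lam + 1 ≠ -(m : ℂ) := by
    simpa using add_natCast_ne_neg_natCast hlam 1
  have hcont : ContinuousAt (fun l => limitCoeff k μ ν l L) lam := by
    have hr := continuous_risingFactorial L
    have hr2 := continuous_risingFactorial (2 * L)
    unfold limitCoeff
    refine ContinuousAt.div (Continuous.continuousAt ?_) (Continuous.continuousAt ?_) ?_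
    · exact (continuous_const.mul hr).mul (hr.comp (continuous_id.add continuous_const))
    · exact (((continuous_const.mul hr2).mul (hr2.comp (continuous_id.add continuous_const))).mul
        continuous_const).mul continuous_const
    · have := risingFactorial_ne_zero hμ L
      have := risingFactorial_ne_zero hν L
      have := risingFactorial_ne_zero hlam (2 * L)
      have := risingFactorial_ne_zero hlam1 (2 * L)
      have := Nat.cast_ne_zero (R := ℂ).2 (Nat.factorial_ne_zero L)
      positivity
  refine (hcont.tendsto.mono_left nhdsWithin_le_nhds).congr' ?_
  filter_upwards [eventually_two_mul_ne_neg_natCast lam] with l hl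
  refine (gegenbauerPrefactor_mul_gegenbauerCoeff k (fun m h => hl (2 * m) ?_)
    (fun m h => hl (2 * m + 1) ?_) hμ hν L).symm
  · push_cast; linear_combination 2 * h
  · push_cast; linear_combination 2 * h

theorem gegenbauerPrefactor_ne_zero {μ ν lam : ℂ} (hlam : ∀ m : ℕ, lam ≠ -(m : ℂ))
    (hhalf : ∀ m : ℕ, lam + 1 / 2 ≠ -(m : ℂ)) (hμ : ∀ m : ℕ, μ + 1 ≠ -(m : ℂ))
    (hν : ∀ m : ℕ, ν + 1 ≠ -(m : ℂ)) : gegenbauerPrefactor μ ν lam ≠ 0 := by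
  have hlam1 : ∀ m : ℕ, lam + 1 ≠ -(m : ℂ) := by
    simpa using add_natCast_ne_neg_natCast hlam 1
  have hs : (Real.sqrt Real.pi : ℂ) ≠ 0 := by
    rw [← Gamma_one_half]; exact Complex.Gamma_ne_zero half_ne_neg_natCast
  have := Complex.Gamma_ne_zero hlam
  have := Complex.Gamma_ne_zero hlam1
  have := Complex.Gamma_ne_zero hhalf
  have := Complex.Gamma_ne_zero hμ
  have := Complex.Gamma_ne_zero hν
  have hμν : (2 : ℂ) ^ (μ + ν) ≠ 0 := by simp [Complex.cpow_eq_zero_iff]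
  unfold gegenbauerPrefactor
  positivity

/-! ### Absolute convergence of the triple series -/

/-- The quotients `(c + m) / (d + m)` are bounded since they tend to `1`. -/
theorem exists_norm_add_natCast_le (c : ℂ) {d : ℂ} (hd : ∀ m : ℕ, d ≠ -(m : ℂ)) :
    ∃ M : ℝ, 0 ≤ M ∧ ∀ m : ℕ, ‖c + m‖ ≤ M * ‖d + m‖ := by
  have h := tendsto_add_mul_div_add_mul_atTop_nhds c d 1 (one_ne_zero (α := ℂ))
  obtain ⟨M, hM⟩ := (Metric.isBounded_range_of_tendsto _ h).exists_norm_le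
  refine ⟨M, (norm_nonneg _).trans (hM _ ⟨0, rfl⟩), fun m => ?_⟩
  have hne : d + m ≠ 0 := by simpa using add_natCast_ne_neg_natCast hd m 0
  have := hM _ ⟨m, rfl⟩
  simp only [one_mul, norm_div] at this
  rwa [div_le_iff₀ (norm_pos_iff.2 hne)] at this

/-- The bound is uniform in the shift `L`, as is needed for the terms of the `₁F₂` functions. -/
theorem exists_norm_risingFactorial_le (c : ℂ) {d : ℂ} (hd : ∀ m : ℕ, d ≠ -(m : ℂ)) :
    ∃ M : ℝ, 0 ≤ M ∧ ∀ L n : ℕ,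
      ‖risingFactorial (c + L) n‖ ≤ M ^ n * ‖risingFactorial (d + L) n‖ := by
  obtain ⟨M, hM0, hM⟩ := exists_norm_add_natCast_le c hd
  refine ⟨M, hM0, fun L n => ?_⟩
  induction n with
  | zero => simp [risingFactorial_zero]
  | succ n ih =>
    have h := hM (L + n)
    push_cast at h
    rw [← add_assoc, ← add_assoc] at h
    rw [risingFactorial_succ, risingFactorial_succ, norm_mul, norm_mul, pow_succ]
    calc _ ≤ M ^ n * ‖risingFactorial (d + L) n‖ * (M * ‖d + L + n‖) := by gcongr
      _ = _ := by ring

theorem exists_one_le_norm_risingFactorial {d : ℂ} (hd : ∀ m : ℕ, d ≠ -(m : ℂ)) :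
    ∃ M : ℝ, 0 ≤ M ∧ ∀ L n : ℕ, 1 ≤ M ^ n * ‖risingFactorial (d + L) n‖ := by
  obtain ⟨M, hM0, hM⟩ := exists_norm_risingFactorial_le 1 hd
  refine ⟨M, hM0, fun L n => le_trans ?_ (hM L n)⟩
  rw [show (1 : ℂ) + L = ((L + 1 : ℕ) : ℂ) by push_cast; ring, risingFactorial,
    ascPochhammer_nat_eq_natCast_ascFactorial, Complex.norm_natCast]
  exact_mod_cast Nat.ascFactorial_pos _ _

/-- The `i`-th term of the series `₁F₂(L + 1/2; 2 L + lam + 1, L + p; z)`. -/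
noncomputable def factorTerm (z lam p : ℂ) (L i : ℕ) : ℂ :=
  risingFactorial (L + 1 / 2) i /
      (risingFactorial (2 * L + lam + 1) i * risingFactorial (L + p) i) * z ^ i / (i.factorial : ℂ)

theorem exists_norm_factorTerm_le (z : ℂ) {lam p : ℂ} (hlam1 : ∀ m : ℕ, lam + 1 ≠ -(m : ℂ))
    (hp : ∀ m : ℕ, p ≠ -(m : ℂ)) :
    ∃ M : ℝ, 0 ≤ M ∧ ∀ L i : ℕ, ‖factorTerm z lam p L i‖ ≤ M ^ i / (i.factorial : ℝ) := by
  obtain ⟨M₁, h₁, H₁⟩ := exists_norm_risingFactorial_le (1 / 2) hp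
  obtain ⟨M₂, h₂, H₂⟩ := exists_one_le_norm_risingFactorial hlam1
  refine ⟨M₁ * M₂ * ‖z‖, by positivity, fun L i => ?_⟩
  have e₁ := H₁ L i
  have e₂ := H₂ (2 * L) i
  rw [factorTerm, norm_div, norm_mul, norm_div, norm_mul, norm_pow, Complex.norm_natCast,
    add_comm (L : ℂ) (1 / 2), add_comm (L : ℂ) p,
    show 2 * (L : ℂ) + lam + 1 = lam + 1 + (2 * L : ℕ) by push_cast; ring, mul_pow, mul_pow]
  gcongr
  have hA : 0 < ‖risingFactorial (lam + 1 + (2 * L : ℕ)) i‖ :=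
    norm_pos_iff.2 (risingFactorial_ne_zero (add_natCast_ne_neg_natCast hlam1 _) i)
  have hB : 0 < ‖risingFactorial (p + L) i‖ :=
    norm_pos_iff.2 (risingFactorial_ne_zero (add_natCast_ne_neg_natCast hp _) i)
  rw [div_le_iff₀ (by positivity)]
  calc _ ≤ M₁ ^ i * ‖risingFactorial (p + L) i‖ * 1 := by simpa using e₁
    _ ≤ M₁ ^ i * ‖risingFactorial (p + L) i‖ *
        (M₂ ^ i * ‖risingFactorial (lam + 1 + (2 * L : ℕ)) i‖) := by gcongr
    _ = _ := by ring

/-- The growth of the numerator is absorbed factor by factor: `(1/2)_L` by `(μ + 1)_L`,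
`(lam + 1/2)_L` by `(ν + 1)_L`, and `(lam)_L` cancels against `(lam)_{2L}`. -/
theorem exists_norm_limitCoeff_le (k : ℂ) {μ ν lam : ℂ} (hlam : ∀ m : ℕ, lam ≠ -(m : ℂ))
    (hμ : ∀ m : ℕ, μ + 1 ≠ -(m : ℂ)) (hν : ∀ m : ℕ, ν + 1 ≠ -(m : ℂ)) :
    ∃ M : ℝ, 0 ≤ M ∧ ∀ L : ℕ, ‖limitCoeff k μ ν lam L‖ ≤ M ^ L / (L.factorial : ℝ) := by
  have hlam1 : ∀ m : ℕ, lam + 1 ≠ -(m : ℂ) := by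
    simpa using add_natCast_ne_neg_natCast hlam 1
  obtain ⟨M₁, h₁, H₁⟩ := exists_norm_risingFactorial_le (1 / 2) hμ
  obtain ⟨M₂, h₂, H₂⟩ := exists_norm_risingFactorial_le (lam + 1 / 2) hν
  obtain ⟨M₃, h₃, H₃⟩ := exists_one_le_norm_risingFactorial hlam
  obtain ⟨M₄, h₄, H₄⟩ := exists_one_le_norm_risingFactorial hlam1
  refine ⟨‖-k ^ 2 / 4‖ ^ 2 * M₁ * M₂ * M₃ * M₄ ^ 2, by positivity, fun L => ?_⟩
  have e₁ := H₁ 0 L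
  have e₂ := H₂ 0 L
  have e₃ := H₃ L L
  have e₄ := H₄ 0 (2 * L)
  simp only [Nat.cast_zero, add_zero] at e₁ e₂ e₄
  have hA : 0 < ‖risingFactorial (μ + 1) L‖ := norm_pos_iff.2 (risingFactorial_ne_zero hμ L)
  have hB : 0 < ‖risingFactorial (ν + 1) L‖ := norm_pos_iff.2 (risingFactorial_ne_zero hν L)
  have hC : 0 < ‖risingFactorial (lam + L) L‖ :=
    norm_pos_iff.2 (risingFactorial_ne_zero (add_natCast_ne_neg_natCast hlam L) L)
  have hD : 0 < ‖risingFactorial (lam + 1) (2 * L)‖ :=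
    norm_pos_iff.2 (risingFactorial_ne_zero hlam1 _)
  have hE : 0 < ‖risingFactorial lam L‖ := norm_pos_iff.2 (risingFactorial_ne_zero hlam L)
  have hs : risingFactorial lam (2 * L) =
      risingFactorial lam L * risingFactorial (lam + L) L := by
    rw [two_mul, risingFactorial_add]
  have hF : (0 : ℝ) < L.factorial := by positivity
  rw [limitCoeff, hs]
  rw [norm_div, norm_mul, norm_mul, norm_mul, norm_mul, norm_mul, norm_mul, norm_mul, norm_mul,
    norm_pow, Complex.norm_natCast, div_le_div_iff₀ (by positivity) hF]
  generalize ‖-k ^ 2 / 4‖ = z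
  calc z ^ (2 * L) * ‖risingFactorial (1 / 2) L‖ * ‖risingFactorial lam L‖ *
        ‖risingFactorial (lam + 1 / 2) L‖ * L.factorial
      = z ^ (2 * L) * ‖risingFactorial lam L‖ * L.factorial * (‖risingFactorial (1 / 2) L‖ *
        ‖risingFactorial (lam + 1 / 2) L‖ * 1 * 1) := by ring
    _ ≤ z ^ (2 * L) * ‖risingFactorial lam L‖ * L.factorial *
        (M₁ ^ L * ‖risingFactorial (μ + 1) L‖ * (M₂ ^ L * ‖risingFactorial (ν + 1) L‖) *
          (M₃ ^ L * ‖risingFactorial (lam + L) L‖) *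
          (M₄ ^ (2 * L) * ‖risingFactorial (lam + 1) (2 * L)‖)) := by
        rw [pow_mul z]
        gcongr
    _ = _ := by
        rw [pow_mul, pow_mul, mul_pow, mul_pow, mul_pow, mul_pow]
        ring

theorem summable_limitCoeff_mul_factorTerm (k : ℂ) {μ ν lam : ℂ}
    (hlam : ∀ m : ℕ, lam ≠ -(m : ℂ))
    (hμ : ∀ m : ℕ, μ + 1 ≠ -(m : ℂ)) (hν : ∀ m : ℕ, ν + 1 ≠ -(m : ℂ)) :
    Summable fun t : ℕ × ℕ × ℕ => limitCoeff k μ ν lam t.1 *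
      (factorTerm (-k ^ 2 / 4) lam (μ + 1) t.1 t.2.1 *
        factorTerm (-k ^ 2 / 4) lam (ν + 1) t.1 t.2.2) := by
  have hlam1 : ∀ m : ℕ, lam + 1 ≠ -(m : ℂ) := by
    simpa using add_natCast_ne_neg_natCast hlam 1
  obtain ⟨M₁, h₁, H₁⟩ := exists_norm_limitCoeff_le k hlam hμ hν
  obtain ⟨M₂, h₂, H₂⟩ := exists_norm_factorTerm_le (-k ^ 2 / 4) hlam1 hμ
  obtain ⟨M₃, h₃, H₃⟩ := exists_norm_factorTerm_le (-k ^ 2 / 4) hlam1 hν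
  have hs := Real.summable_pow_div_factorial
  refine Summable.of_norm_bounded ((hs M₁).mul_of_nonneg ((hs M₂).mul_of_nonneg (hs M₃)
    (fun n => by positivity) (fun n => by positivity)) (fun n => by positivity)
    (fun n => by positivity)) fun t => ?_
  rw [norm_mul, norm_mul]
  gcongr
  · exact H₁ _
  · exact H₂ _ _
  · exact H₃ _ _

theorem hypergeometricPFQ_eq_tsum_factorTerm (z lam p : ℂ) (L : ℕ) :
    hypergeometricPFQ [L + 1 / 2] [2 * L + lam + 1, L + p] z = ∑' i, factorTerm z lam p L i := by
  simp [hypergeometricPFQ, factorTerm]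

/-! ### Two ways of summing the triple series -/

/-- Summation over `(L, i, j)` with `L` outermost gives the bilinear series. -/
theorem hasSum_limitCoeff_mul_pairProduct1F2 (k : ℂ) {μ ν lam : ℂ}
    (hlam : ∀ m : ℕ, lam ≠ -(m : ℂ))
    (hμ : ∀ m : ℕ, μ + 1 ≠ -(m : ℂ)) (hν : ∀ m : ℕ, ν + 1 ≠ -(m : ℂ)) :
    HasSum (fun L : ℕ => limitCoeff k μ ν lam L * pairProduct1F2 k μ ν lam L)
      (∑' t : ℕ × ℕ × ℕ, limitCoeff k μ ν lam t.1 *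
        (factorTerm (-k ^ 2 / 4) lam (μ + 1) t.1 t.2.1 *
          factorTerm (-k ^ 2 / 4) lam (ν + 1) t.1 t.2.2)) := by
  have hlam1 : ∀ m : ℕ, lam + 1 ≠ -(m : ℂ) := by
    simpa using add_natCast_ne_neg_natCast hlam 1
  have hsum : ∀ p : ℂ, (∀ m : ℕ, p ≠ -(m : ℂ)) → ∀ L : ℕ,
      Summable fun i => ‖factorTerm (-k ^ 2 / 4) lam p L i‖ := by
    intro p hp L
    obtain ⟨M, _, H⟩ := exists_norm_factorTerm_le (-k ^ 2 / 4) hlam1 hp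
    exact Summable.of_nonneg_of_le (fun _ => norm_nonneg _) (H L)
      (Real.summable_pow_div_factorial M)
  have hprod : ∀ L, HasSum (fun t : ℕ × ℕ => limitCoeff k μ ν lam L *
      (factorTerm (-k ^ 2 / 4) lam (μ + 1) L t.1 * factorTerm (-k ^ 2 / 4) lam (ν + 1) L t.2))
      (limitCoeff k μ ν lam L * pairProduct1F2 k μ ν lam L) := by
    intro L
    have hu := hsum _ hμ L
    have hv := hsum _ hν L
    rw [pairProduct1F2, add_assoc (L : ℂ) μ, add_assoc (L : ℂ) ν,
      hypergeometricPFQ_eq_tsum_factorTerm, hypergeometricPFQ_eq_tsum_factorTerm]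
    exact (hu.of_norm.hasSum.mul hv.of_norm.hasSum
      (summable_mul_of_summable_norm hu hv)).mul_left _
  exact (summable_limitCoeff_mul_factorTerm k hlam hμ hν).hasSum.prod_fiberwise hprod

/-- With `a = L + i` and `b = L + j`, the dependence of the `(L, i, j)` term on `L` is that of
the very-well-poised summand. -/
theorem limitCoeff_mul_factorTerm_eq (k : ℂ) {μ ν lam : ℂ} (hlam : ∀ m : ℕ, lam ≠ -(m : ℂ))
    (hμ : ∀ m : ℕ, μ + 1 ≠ -(m : ℂ)) (hν : ∀ m : ℕ, ν + 1 ≠ -(m : ℂ)) (L i j : ℕ) :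
    limitCoeff k μ ν lam L * (factorTerm (-k ^ 2 / 4) lam (μ + 1) L i *
      factorTerm (-k ^ 2 / 4) lam (ν + 1) L j) =
    (-k ^ 2 / 4) ^ (L + i + (L + j)) * risingFactorial (1 / 2) (L + i) *
        risingFactorial (1 / 2) (L + j) / (risingFactorial (μ + 1) (L + i) *
          risingFactorial (ν + 1) (L + j) * ((L + i).factorial : ℂ) * ((L + j).factorial : ℂ)) *
      wellPoisedTerm lam (L + i) (L + j) L := by
  have h0 : lam ≠ 0 := by simpa using hlam 0
  have hlam1 : ∀ m : ℕ, lam + 1 ≠ -(m : ℂ) := by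
    simpa using add_natCast_ne_neg_natCast hlam 1
  have hl2 : lam + 2 * L ≠ 0 := by simpa using add_natCast_ne_neg_natCast hlam (2 * L) 0
  have hR := risingFactorial_add_one_left h0 (2 * L)
  push_cast at hR
  have hd : ∀ n : ℕ, ((L + n).factorial : ℂ) =
      ((L + n).descFactorial L : ℂ) * (n.factorial : ℂ) := by
    intro n
    have := Nat.factorial_mul_descFactorial (Nat.le_add_right L n)
    rw [Nat.add_sub_cancel_left] at this
    rw [← this]; push_cast; ring
  have hdne : ∀ n : ℕ, ((L + n).descFactorial L : ℂ) ≠ 0 := fun n h =>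
    Nat.cast_ne_zero (R := ℂ).2 (Nat.factorial_ne_zero (L + n)) (by rw [hd, h, zero_mul])
  have hH := risingFactorial_ne_zero half_ne_neg_natCast L
  have hP := risingFactorial_ne_zero hlam (2 * L)
  have hA := risingFactorial_ne_zero hμ L
  have hB := risingFactorial_ne_zero hν L
  have hA' := risingFactorial_ne_zero (add_natCast_ne_neg_natCast hμ L) i
  have hB' := risingFactorial_ne_zero (add_natCast_ne_neg_natCast hν L) j
  have hC := risingFactorial_ne_zero (add_natCast_ne_neg_natCast hlam1 (2 * L)) i
  have hD := risingFactorial_ne_zero (add_natCast_ne_neg_natCast hlam1 (2 * L)) j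
  have hF := Nat.cast_ne_zero (R := ℂ).2 (Nat.factorial_ne_zero L)
  have hFi := Nat.cast_ne_zero (R := ℂ).2 (Nat.factorial_ne_zero i)
  have hFj := Nat.cast_ne_zero (R := ℂ).2 (Nat.factorial_ne_zero j)
  have hdi := hdne i
  have hdj := hdne j
  rw [limitCoeff, factorTerm, factorTerm, wellPoisedTerm, hd i, hd j,
    show L + i + L = 2 * L + i by ring, show L + j + L = 2 * L + j by ring,
    show L + i + (L + j) = 2 * L + i + j by ring, pow_add, pow_add]
  simp only [risingFactorial_add _ L, risingFactorial_add _ (2 * L)]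
  rw [hR, show 2 * (L : ℂ) + lam + 1 = lam + 1 + (2 * L : ℕ) by push_cast; ring,
    add_comm (L : ℂ) (μ + 1), add_comm (L : ℂ) (ν + 1), add_comm (L : ℂ) (1 / 2)]
  generalize risingFactorial (1 / 2) L = x1 at *
  generalize risingFactorial lam (2 * L) = x2 at *
  generalize risingFactorial (μ + 1) L = x3 at *
  generalize risingFactorial (ν + 1) L = x4 at *
  generalize risingFactorial (μ + 1 + L) i = x5 at *
  generalize risingFactorial (ν + 1 + L) j = x6 at *
  generalize risingFactorial (lam + 1 + (2 * L : ℕ)) i = x7 at *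
  generalize risingFactorial (lam + 1 + (2 * L : ℕ)) j = x8 at *
  generalize risingFactorial (1 / 2 + (L : ℂ)) i = x9 at *
  generalize risingFactorial (1 / 2 + (L : ℂ)) j = x10 at *
  generalize risingFactorial lam L = x11 at *
  generalize risingFactorial (lam + 1 / 2) L = x12 at *
  generalize -k ^ 2 / 4 = z at *
  field_simp

/-- Summation of the triple series over `L` for fixed `a = L + i` and `b = L + j`, by Dougall's
formula. -/
theorem hasSum_prod_of_limitCoeff (k : ℂ) {μ ν lam : ℂ} (hlam : ∀ m : ℕ, lam ≠ -(m : ℂ))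
    (hμ : ∀ m : ℕ, μ + 1 ≠ -(m : ℂ)) (hν : ∀ m : ℕ, ν + 1 ≠ -(m : ℂ)) :
    HasSum (fun ab : ℕ × ℕ => (-k ^ 2 / 4) ^ (ab.1 + ab.2) *
        risingFactorial (1 / 2) (ab.1 + ab.2) / risingFactorial (lam + 1) (ab.1 + ab.2) *
        (1 / (risingFactorial (μ + 1) ab.1 * risingFactorial (ν + 1) ab.2 *
          (ab.1.factorial : ℂ) * (ab.2.factorial : ℂ))))
      (∑' t : ℕ × ℕ × ℕ, limitCoeff k μ ν lam t.1 *
        (factorTerm (-k ^ 2 / 4) lam (μ + 1) t.1 t.2.1 *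
          factorTerm (-k ^ 2 / 4) lam (ν + 1) t.1 t.2.2)) := by
  have hlam1 : ∀ m : ℕ, lam + 1 ≠ -(m : ℂ) := by
    simpa using add_natCast_ne_neg_natCast hlam 1
  set K : ℕ → ℕ → ℂ := fun a b => (-k ^ 2 / 4) ^ (a + b) * risingFactorial (1 / 2) a *
    risingFactorial (1 / 2) b / (risingFactorial (μ + 1) a * risingFactorial (ν + 1) b *
      (a.factorial : ℂ) * (b.factorial : ℂ)) with hK
  have hinj : Function.Injective
      fun t : ℕ × ℕ × ℕ => ((t.1 + t.2.1, t.1 + t.2.2), t.1) := by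
    rintro ⟨L, i, j⟩ ⟨L', i', j'⟩ h
    simp only [Prod.mk.injEq] at h ⊢
    omega
  -- The triples `((a, b), L)` outside the image have `L > min a b`, where the summand vanishes.
  have hzero : ∀ x ∉ Set.range fun t : ℕ × ℕ × ℕ => ((t.1 + t.2.1, t.1 + t.2.2), t.1),
      K x.1.1 x.1.2 * wellPoisedTerm lam x.1.1 x.1.2 x.2 = 0 := by
    rintro ⟨⟨a, b⟩, L⟩ hx
    have : a < L ∨ b < L := by
      by_contra! h
      exact hx ⟨(L, a - L, b - L), by simp [Nat.add_sub_cancel' h.1, Nat.add_sub_cancel' h.2]⟩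
    rcases this with h | h <;> simp [wellPoisedTerm, Nat.descFactorial_of_lt h]
  have hS := (summable_limitCoeff_mul_factorTerm k hlam hμ hν).hasSum
  simp only [limitCoeff_mul_factorTerm_eq k hlam hμ hν] at hS ⊢
  have hS' := (hinj.hasSum_iff hzero).1 hS
  refine hS'.prod_fiberwise fun ab => ?_
  obtain ⟨a, b⟩ := ab
  have hb : ∀ L ∉ Finset.range (b + 1), K a b * wellPoisedTerm lam a b L = 0 := by
    intro L hL
    have : b < L := by simpa [Nat.lt_succ_iff] using hL
    simp [wellPoisedTerm, Nat.descFactorial_of_lt this]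
  have hfin : HasSum (fun L => K a b * wellPoisedTerm lam a b L) _ :=
    hasSum_sum_of_ne_finset_zero hb
  convert hfin using 1
  rw [← Finset.mul_sum, sum_wellPoisedTerm hlam]
  have := risingFactorial_ne_zero half_ne_neg_natCast a
  have := risingFactorial_ne_zero half_ne_neg_natCast b
  simp only [hK]
  generalize risingFactorial (1 / 2) a = x at *
  generalize risingFactorial (1 / 2) b = y at *
  field_simp

/-- The `N`-th term of the `₃F₄`, rewritten with the duplication formula
`4^N ((μ + ν + 1)/2)_N ((μ + ν)/2 + 1)_N = (μ + ν + 1)_{2N}`. -/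
theorem lhs3F4_term_eq (k : ℂ) {μ ν lam : ℂ} (hμν : ∀ m : ℕ, μ + ν + 1 ≠ -(m : ℂ)) (N : ℕ) :
    ([1 / 2, μ / 2 + ν / 2 + 1 / 2, μ / 2 + ν / 2 + 1].map fun c => risingFactorial c N).prod /
      ([lam + 1, μ + 1, ν + 1, μ + ν + 1].map fun c => risingFactorial c N).prod *
        (-k ^ 2) ^ N / (N.factorial : ℂ) =
    (-k ^ 2 / 4) ^ N * risingFactorial (1 / 2) N / risingFactorial (lam + 1) N *
      (risingFactorial (μ + 1 + (ν + 1) - 1 + N) N /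
        (risingFactorial (μ + 1) N * risingFactorial (ν + 1) N * (N.factorial : ℂ))) := by
  have h := risingFactorial_two_mul (μ / 2 + ν / 2 + 1 / 2) N
  rw [show 2 * (μ / 2 + ν / 2 + 1 / 2) = μ + ν + 1 by ring, two_mul N, risingFactorial_add,
    show μ / 2 + ν / 2 + 1 / 2 + 1 / 2 = μ / 2 + ν / 2 + 1 by ring] at h
  have hne := risingFactorial_ne_zero hμν N
  rw [show μ + 1 + (ν + 1) - 1 + N = μ + ν + 1 + N by ring,
    eq_div_of_mul_eq hne ((mul_comm _ _).trans h), div_pow]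
  have h4 : (4 : ℂ) ^ N ≠ 0 := pow_ne_zero _ (by norm_num)
  simp only [List.map_cons, List.map_nil, List.prod_cons, List.prod_nil, mul_one]
  generalize risingFactorial (1 / 2) N = x1
  generalize risingFactorial (μ / 2 + ν / 2 + 1 / 2) N = x2
  generalize risingFactorial (μ / 2 + ν / 2 + 1) N = x3
  generalize (-k ^ 2) ^ N = x4
  field_simp

/-- The bilinear expansion, with the simplified coefficients. -/
theorem hasSum_lhs3F4 (k : ℂ) {μ ν lam : ℂ} (hlam : ∀ m : ℕ, lam ≠ -(m : ℂ))
    (hμ : ∀ m : ℕ, μ + 1 ≠ -(m : ℂ)) (hν : ∀ m : ℕ, ν + 1 ≠ -(m : ℂ))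
    (hμν : ∀ m : ℕ, μ + ν + 1 ≠ -(m : ℂ)) :
    HasSum (fun L : ℕ => limitCoeff k μ ν lam L * pairProduct1F2 k μ ν lam L)
      (lhs3F4 k μ ν lam) := by
  have h := hasSum_limitCoeff_mul_pairProduct1F2 k hlam hμ hν
  have h' := hasSum_prod_of_limitCoeff k hlam hμ hν
  rw [← Finset.HasAntidiagonal.sigmaAntidiagonalEquivProd.hasSum_iff] at h'
  have h'' := h'.sigma fun N => hasSum_fintype _
  convert h using 1
  rw [← h''.tsum_eq, lhs3F4, hypergeometricPFQ]
  refine tsum_congr fun N => ?_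
  rw [lhs3F4_term_eq k hμν, ← sum_antidiagonal_inv_risingFactorial hμ hν, Finset.mul_sum,
    ← Finset.sum_coe_sort]
  refine Finset.sum_congr rfl fun ij _ => ?_
  obtain ⟨⟨i, j⟩, hij⟩ := ij
  obtain rfl : i + j = N := Finset.HasAntidiagonal.mem_antidiagonal.1 hij
  rfl

theorem theorem3 (k μ ν lam : ℂ)
    (hlam : ∀ m : ℕ, lam ≠ -(m : ℂ))
    (hμ : ∀ m : ℕ, μ + 1 ≠ -(m : ℂ))
    (hν : ∀ m : ℕ, ν + 1 ≠ -(m : ℂ))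
    (hμν : ∀ m : ℕ, μ + ν + 1 ≠ -(m : ℂ)) :
    -- the identity itself, for every `lam` at which all the Gamma functions are finite
    ((∀ m : ℕ, lam + 1 / 2 ≠ -(m : ℂ)) →
      Summable (fun L : ℕ => gegenbauerCoeff k μ ν lam L * pairProduct1F2 k μ ν lam L) ∧
      lhs3F4 k μ ν lam = gegenbauerPrefactor μ ν lam *
        ∑' L : ℕ, gegenbauerCoeff k μ ν lam L * pairProduct1F2 k μ ν lam L) ∧
    -- the identity with coefficients understood as limits, which includes `lam = -1/2, -3/2, …`
    (∃ c : ℕ → ℂ,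
      (∀ L : ℕ, Tendsto (fun l : ℂ => gegenbauerPrefactor μ ν l * gegenbauerCoeff k μ ν l L)
        (𝓝[≠] lam) (𝓝 (c L))) ∧
      HasSum (fun L : ℕ => c L * pairProduct1F2 k μ ν lam L) (lhs3F4 k μ ν lam)) := by
  have h := hasSum_lhs3F4 k hlam hμ hν hμν
  refine ⟨fun hhalf => ?_, limitCoeff k μ ν lam,
    tendsto_gegenbauerPrefactor_mul_gegenbauerCoeff k hlam hμ hν, h⟩
  simp only [← gegenbauerPrefactor_mul_gegenbauerCoeff k hlam hhalf hμ hν, mul_assoc] at h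
  refine ⟨(summable_mul_left_iff (gegenbauerPrefactor_ne_zero hlam hhalf hμ hν)).1 h.summable, ?_⟩
  rw [← tsum_mul_left, h.tsum_eq]
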